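/- For integers $r,s,k\ge 0$ let $N_{\rm bi}(r,s,k)$ be the number of connected spanning subgraphs with exactly $r+s+k-1$ edges of the complete bipartite graph $K_{r,s}$ with labelled parts of sizes $r$ and $s$, i.e. the number of connected labelled bipartite graphs with bipartition of sizes $(r,s)$ and Betti number $k$ (the one-vertex graph counts as connected, so that $N_{\rm bi}(1,0,0)=N_{\rm bi}(0,1,0)=1$, and the empty graph does not). Define the formal power series $$F_k(x,y)=\sum_{r,s=0}^{\infty}\frac{N_{\rm bi}(r,s,k)}{r!\,s!}\,x^r y^s\in\mathbb{Q}[[x,y]],\qquad T=F_0,$$ and put $$T_x=x\,\frac{\partial T}{\partial x},\qquad T_y=y\,\frac{\partial T}{\partial y},\qquad Z=T_x+T_y,\qquad W=T_xT_y .$$ Then, as formal power series in $x$ and $y$, $$F_2=f_2(Z,W),\qquad\text{where}\qquad f_2(z,w)=\frac{w^2}{24(1-w)^3}\bigl\{(2+3w)z+2w(6-w)\bigr\},$$ with $f_2$ expanded as a formal power series in $z,w$ (note that $Z$ and $W$ have zero constant term). -/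

import Mathlib

namespace BipartiteEGF

/-- The number of connected bipartite graphs with labelled parts of sizes `r` and `s` and with
first Betti number `k`: the number of connected spanning subgraphs of the complete bipartite graph
`K_{r,s}` that have exactly `r + s + k - 1` edges (written without truncated subtraction). -/
noncomputable def Nbi (r s k : ℕ) : ℕ :=
  Set.ncard {G : SimpleGraph (Fin r ⊕ Fin s) |
    G ≤ completeBipartiteGraph (Fin r) (Fin s) ∧ G.Connected ∧ G.edgeSet.ncard + 1 = r + s + k}

/-- The exponential generating function
`F_k(x, y) = ∑_{r, s ≥ 0} Nbi r s k / (r! s!) x^r y^s`, as a formal power series in `x` (the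
variable with index `0`) and `y` (the variable with index `1`). -/
noncomputable def F (k : ℕ) : MvPowerSeries (Fin 2) ℚ :=
  fun d => (Nbi (d 0) (d 1) k : ℚ) / ((Nat.factorial (d 0) : ℚ) * (Nat.factorial (d 1) : ℚ))

/-- The Euler operator `x ∂_x` for `i = 0`, and `y ∂_y` for `i = 1`. -/
noncomputable def euler (i : Fin 2) (f : MvPowerSeries (Fin 2) ℚ) : MvPowerSeries (Fin 2) ℚ :=
  MvPowerSeries.X i * MvPowerSeries.pderiv ℚ i f

/-- The generating function of the spanning trees. -/
noncomputable def T : MvPowerSeries (Fin 2) ℚ := F 0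

/-- `T_x = x ∂_x T`. -/
noncomputable def Tx : MvPowerSeries (Fin 2) ℚ := euler 0 T

/-- `T_y = y ∂_y T`. -/
noncomputable def Ty : MvPowerSeries (Fin 2) ℚ := euler 1 T

/-- `Z = T_x + T_y`. -/
noncomputable def Z : MvPowerSeries (Fin 2) ℚ := Tx + Ty

/-- `W = T_x T_y`. -/
noncomputable def W : MvPowerSeries (Fin 2) ℚ := Tx * Ty

/-- The rational function `w² / (24 (1 - w)³) * ((2 + 3 w) z + 2 w (6 - w))`, expanded as a formal
power series in `z` (the variable with index `0`) and `w` (the variable with index `1`). -/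
noncomputable def f₂ : MvPowerSeries (Fin 2) ℚ :=
  let z : MvPowerSeries (Fin 2) ℚ := MvPowerSeries.X 0
  let w : MvPowerSeries (Fin 2) ℚ := MvPowerSeries.X 1
  w ^ 2 * (24 * (1 - w) ^ 3)⁻¹ * ((2 + 3 * w) * z + 2 * w * (6 - w))

/-- The inverse in `f₂` is a true inverse. -/
theorem f₂_denominator_mul_inv :
    (24 * (1 - MvPowerSeries.X 1) ^ 3 : MvPowerSeries (Fin 2) ℚ) *
      (24 * (1 - MvPowerSeries.X 1) ^ 3 : MvPowerSeries (Fin 2) ℚ)⁻¹ = 1 := by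
  apply MvPowerSeries.mul_inv_cancel
  have h : MvPowerSeries.constantCoeff (24 : MvPowerSeries (Fin 2) ℚ) = 24 := map_ofNat _ 24
  simp [h]

/-- `Z` and `W` have no constant term, so they may be substituted into any power series. -/
theorem hasSubst_Z_W : MvPowerSeries.HasSubst ![Z, W] := by
  apply MvPowerSeries.hasSubst_of_constantCoeff_zero
  intro i
  fin_cases i <;> simp [Z, W, Tx, Ty, euler]

end BipartiteEGF

/-! Count connected bipartite graphs with a marked edge. If the edge is not a bridge, deleting it
leaves a connected graph of Betti number one less with a marked non-edge (`card_nonbridge`). If it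
is a bridge, deleting it leaves two connected pieces whose Betti numbers add up to the original one
(`card_bridge`). The endpoint of the bridge in the left part orders the two pieces, so no factor 1/2
appears.

For the generating functions this gives differential equations in the Euler operators:
`F_zero_equation` for trees, `F_succ_equation` for higher Betti numbers. Their leading part is D -
c, where D is the sum of the two Euler operators and c an integer. D multiplies the degree n part by
n, so a solution is determined once its parts of degree at most c are known
(`eq_zero_of_euler_system`). It then suffices to verify closed forms.

This is done three times. The second derivatives of T become rational in T_x and T_y, with
denominator 1 - W (`euler_Ty_mul` and its consequences). Then the gradient of F_1 is found
(`euler_F_one`); F_1 itself would involve log(1 - W), but only its derivatives enter the equation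
for F_2. Finally f_2(Z, W) is checked against that equation (`F_two_eq`). -/

namespace BipartiteEGF

open Finset

/-! ### Bipartite graphs as edge sets, and connectivity -/

section Graph

variable {α β : Type*}

/-- The bipartite graph on `α ⊕ β` with edge set `E`. -/
def graphOf (E : Finset (α × β)) : SimpleGraph (α ⊕ β) where
  Adj u v := ∃ p ∈ E, u = .inl p.1 ∧ v = .inr p.2 ∨ u = .inr p.2 ∧ v = .inl p.1
  symm := ⟨fun _ _ ⟨p, hp, h⟩ => ⟨p, hp, h.symm.imp And.symm And.symm⟩⟩
  loopless := ⟨fun u ⟨p, _, h⟩ => by rcases h with ⟨h, h'⟩ | ⟨h, h'⟩ <;> simp_all⟩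

theorem graphOf_adj {E : Finset (α × β)} {u v : α ⊕ β} :
    (graphOf E).Adj u v ↔
      ∃ p ∈ E, u = .inl p.1 ∧ v = .inr p.2 ∨ u = .inr p.2 ∧ v = .inl p.1 :=
  Iff.rfl

theorem reachable_of_mem {E : Finset (α × β)} {p : α × β} (hp : p ∈ E) :
    (graphOf E).Reachable (.inl p.1) (.inr p.2) :=
  SimpleGraph.Adj.reachable (graphOf_adj.2 ⟨p, hp, .inl ⟨rfl, rfl⟩⟩)

theorem graphOf_mono {E E' : Finset (α × β)} (h : E ⊆ E') : graphOf E ≤ graphOf E' :=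
  fun _ _ ⟨p, hp, h'⟩ => ⟨p, h hp, h'⟩

/-- Induction along a path of a bipartite graph. -/
theorem reachable_induction {E : Finset (α × β)} {u : α ⊕ β} {P : α ⊕ β → Prop} (h0 : P u)
    (hl : ∀ p ∈ E, P (.inl p.1) → P (.inr p.2)) (hr : ∀ p ∈ E, P (.inr p.2) → P (.inl p.1))
    {v : α ⊕ β} (h : (graphOf E).Reachable u v) : P v := by
  rw [SimpleGraph.reachable_iff_reflTransGen] at h
  induction h with
  | refl => exact h0
  | tail _ hadj ih =>
    obtain ⟨p, hp, ⟨rfl, rfl⟩ | ⟨rfl, rfl⟩⟩ := hadj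
    exacts [hl p hp ih, hr p hp ih]

/-- The edge set `E` lies inside the vertex set `S` and connects it. -/
def ConnOn (S : Finset (α ⊕ β)) (E : Finset (α × β)) : Prop :=
  (∀ p ∈ E, .inl p.1 ∈ S ∧ .inr p.2 ∈ S) ∧ S.Nonempty ∧
    ∀ u ∈ S, ∀ v ∈ S, (graphOf E).Reachable u v

theorem connOn_of_root {S : Finset (α ⊕ β)} {E : Finset (α × β)} {w : α ⊕ β}
    (hE : ∀ p ∈ E, .inl p.1 ∈ S ∧ .inr p.2 ∈ S) (hw : w ∈ S)
    (h : ∀ v ∈ S, (graphOf E).Reachable w v) : ConnOn S E :=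
  ⟨hE, ⟨w, hw⟩, fun u hu v hv => (h u hu).symm.trans (h v hv)⟩

theorem ConnOn.mono [Fintype α] [Fintype β] {E E' : Finset (α × β)} (h : E ⊆ E')
    (hE : ConnOn univ E) : ConnOn univ E' :=
  ⟨by simp, hE.2.1, fun u hu v hv => (hE.2.2 u hu v hv).mono (graphOf_mono h)⟩

theorem connOn_univ_iff [Fintype α] [Fintype β] {E : Finset (α × β)} :
    ConnOn univ E ↔ (graphOf E).Connected := by
  rw [SimpleGraph.connected_iff_exists_forall_reachable]
  constructor
  · rintro ⟨-, ⟨u, hu⟩, h⟩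
    exact ⟨u, fun v => h u hu v (mem_univ _)⟩
  · rintro ⟨u, h⟩
    exact connOn_of_root (by simp) (mem_univ u) (fun v _ => h v)

/-- Reachability inside a union of components only uses the edges in it. -/
theorem reachable_filter {E : Finset (α × β)} {S : Finset (α ⊕ β)}
    [DecidablePred fun p : α × β => (.inl p.1 : α ⊕ β) ∈ S]
    (hS : ∀ p ∈ E, (.inl p.1 : α ⊕ β) ∈ S ↔ (.inr p.2 : α ⊕ β) ∈ S) {u v : α ⊕ β} (hu : u ∈ S)
    (h : (graphOf E).Reachable u v) :
    v ∈ S ∧ (graphOf (E.filter fun p => .inl p.1 ∈ S)).Reachable u v := by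
  refine reachable_induction (P := fun v => v ∈ S ∧
    (graphOf (E.filter fun p => .inl p.1 ∈ S)).Reachable u v) ⟨hu, .refl _⟩ ?_ ?_ h
  · rintro p hp ⟨h1, h2⟩
    exact ⟨(hS p hp).1 h1, h2.trans (reachable_of_mem (by simp [hp, h1]))⟩
  · rintro p hp ⟨h1, h2⟩
    have h3 := (hS p hp).2 h1
    exact ⟨h3, h2.trans (reachable_of_mem (by simp [hp, h3])).symm⟩

theorem graphOf_injective : Function.Injective (graphOf : Finset (α × β) → _) := by
  intro E E' h
  have key : ∀ (E : Finset (α × β)) p, p ∈ E ↔ (graphOf E).Adj (.inl p.1) (.inr p.2) := by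
    intro E p
    constructor
    · exact fun hp => ⟨p, hp, .inl ⟨rfl, rfl⟩⟩
    · rintro ⟨q, hq, ⟨h1, h2⟩ | ⟨h1, h2⟩⟩
      · rw [Sum.inl.injEq] at h1
        rw [Sum.inr.injEq] at h2
        rwa [Prod.ext h1 h2]
      · simp at h1
  ext p
  rw [key, key, h]

theorem ncard_edgeSet_graphOf (E : Finset (α × β)) : (graphOf E).edgeSet.ncard = E.card := by
  have h : (graphOf E).edgeSet =
      (fun p : α × β => s((.inl p.1 : α ⊕ β), (.inr p.2 : α ⊕ β))) '' (E : Set (α × β)) := by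
    ext e
    induction e with | _ u v
    simp only [SimpleGraph.mem_edgeSet, graphOf_adj, Set.mem_image, mem_coe, Sym2.eq_iff]
    refine exists_congr fun p => and_congr_right fun _ => ?_
    constructor
    · rintro (⟨rfl, rfl⟩ | ⟨rfl, rfl⟩) <;> simp
    · rintro (⟨rfl, rfl⟩ | ⟨rfl, rfl⟩) <;> simp
  rw [h, Set.ncard_image_of_injective, Set.ncard_coe_finset]
  rintro ⟨a, b⟩ ⟨c, d⟩ h
  simpa using h

theorem graphOf_le (E : Finset (α × β)) : graphOf E ≤ completeBipartiteGraph α β := by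
  rintro u v ⟨p, _, ⟨rfl, rfl⟩ | ⟨rfl, rfl⟩⟩ <;> simp [completeBipartiteGraph]

theorem exists_graphOf_eq [Fintype α] [Fintype β] {G : SimpleGraph (α ⊕ β)}
    (hG : G ≤ completeBipartiteGraph α β) : ∃ E, graphOf E = G := by
  classical
  refine ⟨univ.filter fun p => G.Adj (.inl p.1) (.inr p.2), ?_⟩
  ext u v
  simp only [graphOf_adj, mem_filter, mem_univ, true_and]
  constructor
  · rintro ⟨p, hp, ⟨rfl, rfl⟩ | ⟨rfl, rfl⟩⟩
    exacts [hp, hp.symm]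
  · intro h
    have h' := hG h
    rcases u with a | a <;> rcases v with b | b <;> simp [completeBipartiteGraph] at h'
    · exact ⟨(a, b), h, .inl ⟨rfl, rfl⟩⟩
    · exact ⟨(b, a), h.symm, .inr ⟨rfl, rfl⟩⟩

theorem ConnOn.card_univ_le [Fintype α] [Fintype β] {E : Finset (α × β)} (h : ConnOn univ E) :
    Fintype.card (α ⊕ β) ≤ E.card + 1 := by
  have := (connOn_univ_iff.1 h).card_vert_le_card_edgeSet_add_one
  rwa [Nat.card_eq_fintype_card, Nat.card_coe_set_eq, ncard_edgeSet_graphOf] at this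

open Classical in
/-- The edge sets inside `S` that connect `S` with Betti number `k`. -/
noncomputable def connSet [Fintype α] [Fintype β] (S : Finset (α ⊕ β)) (k : ℕ) :
    Finset (Finset (α × β)) :=
  univ.filter fun E => ConnOn S E ∧ E.card + 1 = S.card + k

theorem mem_connSet [Fintype α] [Fintype β] {S : Finset (α ⊕ β)} {k : ℕ} {E : Finset (α × β)} :
    E ∈ connSet S k ↔ ConnOn S E ∧ E.card + 1 = S.card + k := by
  simp [connSet]

theorem card_connSet_fin (r s k : ℕ) :
    (connSet (univ : Finset (Fin r ⊕ Fin s)) k).card = Nbi r s k := by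
  rw [Nbi, ← Set.ncard_coe_finset, ← Set.ncard_image_of_injective _ graphOf_injective]
  congr 1
  ext G
  simp only [Set.mem_image, mem_coe, mem_connSet, Set.mem_ofPred_eq, connOn_univ_iff]
  constructor
  · rintro ⟨E, ⟨h1, h2⟩, rfl⟩
    refine ⟨graphOf_le E, h1, ?_⟩
    rw [ncard_edgeSet_graphOf, h2]
    simp
  · rintro ⟨h1, h2, h3⟩
    obtain ⟨E, rfl⟩ := exists_graphOf_eq h1
    rw [ncard_edgeSet_graphOf] at h3
    exact ⟨E, ⟨h2, by simpa using h3⟩, rfl⟩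

/-! ### Transport along embeddings of the two parts -/

section Transport

variable {α' β' : Type*} [Fintype α'] [Fintype β'] (f : α' ↪ α) (g : β' ↪ β)

theorem connOn_map_iff {S : Finset (α ⊕ β)} (hS : S = univ.map (f.sumMap g))
    (E : Finset (α' × β')) : ConnOn S (E.map (f.prodMap g)) ↔ ConnOn univ E := by
  subst hS
  have reach : ∀ u v : α' ⊕ β', (graphOf (E.map (f.prodMap g))).Reachable
      (f.sumMap g u) (f.sumMap g v) ↔ (graphOf E).Reachable u v := by
    intro u v
    constructor
    · intro h
      have := reachable_induction (P := fun w => ∀ v, w = f.sumMap g v →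
        (graphOf E).Reachable u v) ?_ ?_ ?_ h
      · exact this v rfl
      · intro v hv
        rw [(f.sumMap g).injective hv]
      · intro p hp ih v hv
        obtain ⟨q, hq, rfl⟩ := mem_map.1 hp
        obtain rfl : .inr q.2 = v := (f.sumMap g).injective hv
        exact (ih (.inl q.1) rfl).trans (reachable_of_mem hq)
      · intro p hp ih v hv
        obtain ⟨q, hq, rfl⟩ := mem_map.1 hp
        obtain rfl : .inl q.1 = v := (f.sumMap g).injective hv
        exact (ih (.inr q.2) rfl).trans (reachable_of_mem hq).symm
    · intro h
      refine reachable_induction (P := fun v => (graphOf (E.map (f.prodMap g))).Reachable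
        (f.sumMap g u) (f.sumMap g v)) (.refl _) ?_ ?_ h
      · exact fun p hp ih => ih.trans (reachable_of_mem (mem_map_of_mem (f.prodMap g) hp))
      · exact fun p hp ih => ih.trans (reachable_of_mem (mem_map_of_mem (f.prodMap g) hp)).symm
  unfold ConnOn
  refine and_congr ?_ (and_congr (by simp) ?_)
  · simp only [mem_univ, and_self, implies_true, iff_true]
    intro p hp
    obtain ⟨q, hq, rfl⟩ := mem_map.1 hp
    exact ⟨mem_map_of_mem (f.sumMap g) (mem_univ (.inl q.1)),
      mem_map_of_mem (f.sumMap g) (mem_univ (.inr q.2))⟩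
  · simp only [forall_mem_map, mem_univ, forall_true_left, reach]

theorem ConnOn.exists_map_eq {S : Finset (α ⊕ β)} (hS : S = univ.map (f.sumMap g))
    {E : Finset (α × β)} (hE : ConnOn S E) : ∃ E' : Finset (α' × β'), E'.map (f.prodMap g) = E := by
  classical
  refine ⟨univ.filter fun p => f.prodMap g p ∈ E, ?_⟩
  ext p
  simp only [mem_map, mem_filter, mem_univ, true_and]
  constructor
  · rintro ⟨q, hq, rfl⟩
    exact hq
  · intro hp
    have h := hE.1 p hp
    rw [hS, mem_map, mem_map] at h
    obtain ⟨⟨a | a, -, ha⟩, ⟨b | b, -, hb⟩⟩ := h <;>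
      simp only [Function.Embedding.sumMap, Function.Embedding.coeFn_mk, Sum.map_inl, Sum.map_inr,
        reduceCtorEq, Sum.inl.injEq, Sum.inr.injEq] at ha hb
    exact ⟨(a, b), by rw [show f.prodMap g (a, b) = p from Prod.ext ha hb]; exact hp,
      Prod.ext ha hb⟩

end Transport

theorem exists_embedding (S : Finset (α ⊕ β)) :
    ∃ (f : Fin S.toLeft.card ↪ α) (g : Fin S.toRight.card ↪ β), S = univ.map (f.sumMap g) := by
  refine ⟨S.toLeft.equivFin.symm.toEmbedding.trans (.subtype _),
    S.toRight.equivFin.symm.toEmbedding.trans (.subtype _), ?_⟩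
  ext (a | b)
  · constructor
    · intro h
      exact mem_map.2 ⟨.inl (S.toLeft.equivFin ⟨a, by simpa using h⟩), by simp⟩
    · intro h
      obtain ⟨c | c, -, h⟩ := mem_map.1 h
      · obtain rfl := Sum.inl_injective h
        exact mem_toLeft.1 (S.toLeft.equivFin.symm c).2
      · exact absurd h (by simp)
  · constructor
    · intro h
      exact mem_map.2 ⟨.inr (S.toRight.equivFin ⟨b, by simpa using h⟩), by simp⟩
    · intro h
      obtain ⟨c | c, -, h⟩ := mem_map.1 h
      · exact absurd h (by simp)
      · obtain rfl := Sum.inr_injective h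
        exact mem_toRight.1 (S.toRight.equivFin.symm c).2

/-- An edge set connecting `S` is the image of one connecting a full vertex set of the same part
sizes, so the count depends on these sizes only. -/
theorem card_connSet [Fintype α] [Fintype β] (S : Finset (α ⊕ β)) (k : ℕ) :
    (connSet S k).card = Nbi S.toLeft.card S.toRight.card k := by
  obtain ⟨f, g, hS⟩ := exists_embedding S
  have hcard : S.card = (univ : Finset (Fin S.toLeft.card ⊕ Fin S.toRight.card)).card := by
    simp [card_toLeft_add_card_toRight]
  rw [← card_connSet_fin]
  symm
  refine card_nbij (fun E => E.map (f.prodMap g)) ?_ ?_ ?_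
  · intro E hE
    rw [mem_coe, mem_connSet] at *
    rw [connOn_map_iff f g hS, card_map, hcard]
    exact hE
  · exact fun E _ E' _ h => map_injective _ h
  · intro E hE
    rw [mem_coe, mem_connSet] at hE
    obtain ⟨E', rfl⟩ := hE.1.exists_map_eq f g hS
    rw [connOn_map_iff f g hS, card_map, hcard] at hE
    exact ⟨E', mem_connSet.2 hE, rfl⟩

theorem ConnOn.card_le {S : Finset (α ⊕ β)} {E : Finset (α × β)} (h : ConnOn S E) :
    S.card ≤ E.card + 1 := by
  obtain ⟨f, g, hS⟩ := exists_embedding S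
  obtain ⟨E', rfl⟩ := h.exists_map_eq f g hS
  have := ((connOn_map_iff f g hS E').1 h).card_univ_le
  simpa [card_toLeft_add_card_toRight] using this

end Graph
-- Marked edges: bridges and non-bridges
section Split

variable {α β : Type*} [Fintype α] [Fintype β] [DecidableEq α] [DecidableEq β]

/-- `E₁` connects `S`, `E₂` connects the complement of `S`, and the edge `e` leads from `S` to its
complement. -/
structure Splits (S : Finset (α ⊕ β)) (e : α × β) (E₁ E₂ : Finset (α × β)) : Prop where
  left : ConnOn S E₁
  right : ConnOn Sᶜ E₂
  inl_mem : .inl e.1 ∈ S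
  inr_mem : .inr e.2 ∈ Sᶜ

namespace Splits

variable {S : Finset (α ⊕ β)} {e : α × β} {E₁ E₂ : Finset (α × β)}

theorem notMem (h : Splits S e E₁ E₂) : e ∉ E₁ ∪ E₂ := by
  intro he
  rcases mem_union.1 he with he | he
  · exact mem_compl.1 h.inr_mem (h.left.1 e he).2
  · exact mem_compl.1 (h.right.1 e he).1 h.inl_mem

theorem filter_left (h : Splits S e E₁ E₂) :
    (E₁ ∪ E₂).filter (fun p => (.inl p.1 : α ⊕ β) ∈ S) = E₁ := by
  ext p
  simp only [mem_filter, mem_union]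
  constructor
  · rintro ⟨hp | hp, hS⟩
    · exact hp
    · exact absurd hS (mem_compl.1 (h.right.1 p hp).1)
  · exact fun hp => ⟨.inl hp, (h.left.1 p hp).1⟩

theorem filter_right (h : Splits S e E₁ E₂) :
    (E₁ ∪ E₂).filter (fun p => (.inl p.1 : α ⊕ β) ∉ S) = E₂ := by
  ext p
  simp only [mem_filter, mem_union]
  constructor
  · rintro ⟨hp | hp, hS⟩
    · exact absurd (h.left.1 p hp).1 hS
    · exact hp
  · exact fun hp => ⟨.inr hp, mem_compl.1 (h.right.1 p hp).1⟩

theorem card_union (h : Splits S e E₁ E₂) : (E₁ ∪ E₂).card = E₁.card + E₂.card := by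
  rw [← card_filter_add_card_filter_not (s := E₁ ∪ E₂) fun p => (.inl p.1 : α ⊕ β) ∈ S,
    h.filter_left, h.filter_right]

theorem reachable_iff (h : Splits S e E₁ E₂) {v : α ⊕ β} :
    (graphOf (E₁ ∪ E₂)).Reachable (.inl e.1) v ↔ v ∈ S := by
  constructor
  · refine fun hv => (reachable_filter ?_ h.inl_mem hv).1
    intro p hp
    rcases mem_union.1 hp with hp | hp
    · simp [h.left.1 p hp]
    · have := h.right.1 p hp
      simp only [mem_compl] at this
      simp [this]
  · exact fun hv => (h.left.2.2 _ h.inl_mem _ hv).mono (graphOf_mono subset_union_left)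

theorem not_connOn (h : Splits S e E₁ E₂) : ¬ ConnOn univ (E₁ ∪ E₂) := fun hc =>
  mem_compl.1 h.inr_mem (h.reachable_iff.1 (hc.2.2 _ (mem_univ _) _ (mem_univ _)))

theorem connOn_insert (h : Splits S e E₁ E₂) : ConnOn univ (insert e (E₁ ∪ E₂)) := by
  refine connOn_of_root (by simp) (mem_univ (.inl e.1)) fun v _ => ?_
  by_cases hv : v ∈ S
  · exact (h.reachable_iff.2 hv).mono (graphOf_mono (subset_insert _ _))
  · refine (reachable_of_mem (mem_insert_self _ _)).trans ?_
    exact (h.right.2.2 _ h.inr_mem _ (mem_compl.2 hv)).mono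
      (graphOf_mono (subset_union_right.trans (subset_insert _ _)))

/-- Deleting `e` recovers the union of the pieces, and `S` is then the component of the left
endpoint of `e`. This is the injectivity needed to count marked bridges. -/
theorem unique (h : Splits S e E₁ E₂) {S' : Finset (α ⊕ β)} {E₁' E₂' : Finset (α × β)}
    (h' : Splits S' e E₁' E₂') (hE : insert e (E₁ ∪ E₂) = insert e (E₁' ∪ E₂')) :
    S = S' ∧ E₁ = E₁' ∧ E₂ = E₂' := by
  have hU : E₁ ∪ E₂ = E₁' ∪ E₂' := by
    rw [← erase_insert h.notMem, hE, erase_insert h'.notMem]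
  have hS : S = S' := by
    ext v
    rw [← h.reachable_iff, hU, h'.reachable_iff]
  subst hS
  refine ⟨rfl, ?_, ?_⟩
  · rw [← h.filter_left, hU, h'.filter_left]
  · rw [← h.filter_right, hU, h'.filter_right]

end Splits

/-- Removing a bridge splits a connected graph into two connected pieces. -/
theorem ConnOn.exists_splits {E : Finset (α × β)} {e : α × β} (hE : ConnOn univ E) (he : e ∈ E)
    (hne : ¬ ConnOn univ (E.erase e)) :
    ∃ S E₁ E₂, Splits S e E₁ E₂ ∧ E₁ ∪ E₂ = E.erase e := by
  classical
  set E' := E.erase e with hE'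
  have hmem : ∀ p ∈ E, p = e ∨ p ∈ E' := fun p hp =>
    (eq_or_ne p e).imp_right fun h => mem_erase.2 ⟨h, hp⟩
  -- A path that uses `e` can be restarted at the endpoint of `e` last reached.
  have hcover : ∀ v, (graphOf E').Reachable (.inl e.1) v ∨ (graphOf E').Reachable (.inr e.2) v := by
    intro v
    refine reachable_induction (P := fun v => (graphOf E').Reachable (.inl e.1) v ∨
      (graphOf E').Reachable (.inr e.2) v) (.inl (.refl _)) ?_ ?_
      (hE.2.2 (.inl e.1) (mem_univ _) v (mem_univ _))
    · intro p hp ih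
      rcases hmem p hp with rfl | hp
      · exact .inr (.refl _)
      · exact ih.imp (·.trans (reachable_of_mem hp)) (·.trans (reachable_of_mem hp))
    · intro p hp ih
      rcases hmem p hp with rfl | hp
      · exact .inl (.refl _)
      · exact ih.imp (·.trans (reachable_of_mem hp).symm) (·.trans (reachable_of_mem hp).symm)
  have hsep : ¬ (graphOf E').Reachable (.inl e.1) (.inr e.2) := fun h =>
    hne (connOn_of_root (by simp) (mem_univ (.inl e.1)) fun v _ =>
      (hcover v).elim id fun hv => h.trans hv)
  -- The component of the left endpoint; by `hcover` and `hsep` its complement is the component of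
  -- the right endpoint.
  set S : Finset (α ⊕ β) := univ.filter fun v => (graphOf E').Reachable (.inl e.1) v with hS
  have memS : ∀ v, v ∈ S ↔ (graphOf E').Reachable (.inl e.1) v := by simp [hS]
  have memSc : ∀ v, v ∈ Sᶜ ↔ (graphOf E').Reachable (.inr e.2) v := by
    intro v
    rw [mem_compl, memS]
    exact ⟨fun h => (hcover v).resolve_left h, fun h h' => hsep (h'.trans h.symm)⟩
  have closed : ∀ p ∈ E', (.inl p.1 : α ⊕ β) ∈ S ↔ (.inr p.2 : α ⊕ β) ∈ S := by
    intro p hp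
    rw [memS, memS]
    exact ⟨(·.trans (reachable_of_mem hp)), (·.trans (reachable_of_mem hp).symm)⟩
  have closed' : ∀ p ∈ E', (.inl p.1 : α ⊕ β) ∈ Sᶜ ↔ (.inr p.2 : α ⊕ β) ∈ Sᶜ := by
    intro p hp
    rw [mem_compl, mem_compl, closed p hp]
  have hl : Sum.inl e.1 ∈ S := (memS _).2 (.refl _)
  have hr : Sum.inr e.2 ∈ Sᶜ := (memSc _).2 (.refl _)
  refine ⟨S, E'.filter fun p => .inl p.1 ∈ S, E'.filter fun p => .inl p.1 ∈ Sᶜ,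
    ⟨connOn_of_root ?_ hl ?_, connOn_of_root ?_ hr ?_, hl, hr⟩, ?_⟩
  · intro p hp
    rw [mem_filter] at hp
    exact ⟨hp.2, (closed p hp.1).1 hp.2⟩
  · exact fun v hv => (reachable_filter closed hl ((memS v).1 hv)).2
  · intro p hp
    rw [mem_filter] at hp
    exact ⟨hp.2, (closed' p hp.1).1 hp.2⟩
  · exact fun v hv => (reachable_filter closed' hr ((memSc v).1 hv)).2
  · simp only [mem_compl]
    exact filter_union_filter_not_eq _ _

/-- Connected graphs with a marked edge whose removal keeps the graph connected. -/
theorem card_nonbridge (k : ℕ) :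
    open Classical in
    (((connSet (univ : Finset (α ⊕ β)) k).sigma fun E => E).filter
      fun x => ConnOn univ (x.1.erase x.2)).card =
    ((univ.filter fun E : Finset (α × β) => ConnOn univ E ∧
      E.card + 2 = Fintype.card (α ⊕ β) + k).sigma fun E => Eᶜ).card := by
  classical
  refine card_nbij' (fun x => ⟨x.1.erase x.2, x.2⟩) (fun x => ⟨insert x.2 x.1, x.2⟩) ?_ ?_ ?_ ?_
  · rintro ⟨E, e⟩ h
    simp only [coe_filter, mem_sigma, mem_connSet, card_univ, Set.mem_ofPred_eq, mem_coe,
      mem_filter, mem_univ, true_and, mem_compl] at h ⊢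
    refine ⟨⟨h.2, ?_⟩, notMem_erase _ _⟩
    rw [← h.1.1.2, ← card_erase_add_one h.1.2]
  · rintro ⟨E, e⟩ h
    simp only [coe_filter, mem_sigma, mem_connSet, card_univ, Set.mem_ofPred_eq, mem_coe,
      mem_filter, mem_univ, true_and, mem_compl] at h ⊢
    rw [erase_insert h.2, card_insert_of_notMem h.2]
    exact ⟨⟨⟨h.1.1.mono (subset_insert _ _), h.1.2⟩, mem_insert_self _ _⟩, h.1.1⟩
  · rintro ⟨E, e⟩ h
    simp only [coe_filter, mem_sigma, Set.mem_ofPred_eq] at h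
    simp [insert_erase h.1.2]
  · rintro ⟨E, e⟩ h
    simp only [mem_coe, mem_sigma, mem_compl] at h
    simp [erase_insert h.2]

/-- Connected graphs with a marked bridge. -/
theorem card_bridge (k : ℕ) :
    open Classical in
    (((connSet (univ : Finset (α ⊕ β)) k).sigma fun E => E).filter
      fun x => ¬ ConnOn univ (x.1.erase x.2)).card =
    ((univ : Finset (Finset (α ⊕ β))).sigma fun S => (S.toLeft ×ˢ Sᶜ.toRight).sigma fun _ =>
      (antidiagonal k).sigma fun κ => connSet S κ.1 ×ˢ connSet Sᶜ κ.2).card := by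
  classical
  symm
  have key : ∀ {S : Finset (α ⊕ β)} {e : α × β} {κ : ℕ × ℕ} {E : Finset (α × β) × Finset (α × β)},
      (⟨S, e, κ, E⟩ : Σ _ : Finset (α ⊕ β), Σ _ : α × β, Σ _ : ℕ × ℕ, _) ∈
        ((univ : Finset (Finset (α ⊕ β))).sigma fun S => (S.toLeft ×ˢ Sᶜ.toRight).sigma fun _ =>
          (antidiagonal k).sigma fun κ => connSet S κ.1 ×ˢ connSet Sᶜ κ.2) ↔
      Splits S e E.1 E.2 ∧ κ.1 + κ.2 = k ∧ E.1.card + 1 = S.card + κ.1 ∧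
        E.2.card + 1 = Sᶜ.card + κ.2 := by
    intro S e κ E
    simp only [mem_sigma, mem_univ, true_and, mem_product, mem_toLeft, mem_toRight,
      HasAntidiagonal.mem_antidiagonal, mem_connSet]
    constructor
    · rintro ⟨⟨h1, h2⟩, h3, ⟨h4, h5⟩, h6, h7⟩
      exact ⟨⟨h4, h6, h1, h2⟩, h3, h5, h7⟩
    · rintro ⟨⟨h4, h6, h1, h2⟩, h3, h5, h7⟩
      exact ⟨⟨h1, h2⟩, h3, ⟨h4, h5⟩, h6, h7⟩
  refine card_nbij (fun x => ⟨insert x.2.1 (x.2.2.2.1 ∪ x.2.2.2.2), x.2.1⟩) ?_ ?_ ?_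
  · rintro ⟨S, e, κ, E⟩ h
    obtain ⟨h, hk, h1, h2⟩ := key.1 (mem_coe.1 h)
    have h3 := card_add_card_compl S
    simp only [coe_filter, mem_sigma, mem_connSet, card_univ, Set.mem_ofPred_eq]
    rw [erase_insert h.notMem, card_insert_of_notMem h.notMem, h.card_union]
    exact ⟨⟨⟨h.connOn_insert, by omega⟩, mem_insert_self _ _⟩, h.not_connOn⟩
  · rintro ⟨S, e, κ, E⟩ h ⟨S', e', κ', E'⟩ h' heq
    obtain ⟨h, hk, h1, h2⟩ := key.1 (mem_coe.1 h)
    obtain ⟨h', hk', h1', h2'⟩ := key.1 (mem_coe.1 h')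
    simp only [Sigma.mk.injEq, heq_eq_eq] at heq
    obtain ⟨heq, rfl⟩ := heq
    obtain ⟨rfl, hE1, hE2⟩ := h.unique h' heq
    obtain rfl : E = E' := Prod.ext hE1 hE2
    obtain rfl : κ = κ' := Prod.ext (by omega) (by omega)
    rfl
  · rintro ⟨E, e⟩ h
    simp only [coe_filter, mem_sigma, mem_connSet, card_univ, Set.mem_ofPred_eq] at h
    obtain ⟨⟨⟨hE, hc⟩, he⟩, hne⟩ := h
    obtain ⟨S, E₁, E₂, hs, hU⟩ := hE.exists_splits he hne
    have h1 := hs.left.card_le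
    have h2 := hs.right.card_le
    have h3 := card_add_card_compl S
    have h4 := card_erase_add_one he
    rw [← hU, hs.card_union] at h4
    -- The Betti numbers of the pieces are forced by their sizes; the truncated subtractions are
    -- exact because of `ConnOn.card_le`.
    refine ⟨⟨S, e, (E₁.card + 1 - S.card, E₂.card + 1 - Sᶜ.card), (E₁, E₂)⟩, mem_coe.2
      (key.2 ⟨hs, by dsimp only; omega, by dsimp only; omega, by dsimp only; omega⟩), ?_⟩
    simp [hU, insert_erase he]

end Split

/-! ### Recursions for the counting numbers -/

theorem sum_sum_toLeft_toRight {M : Type*} [AddCommMonoid M] (r s : ℕ) (g : ℕ → ℕ → M) :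
    ∑ S : Finset (Fin r ⊕ Fin s), g S.toLeft.card S.toRight.card =
      ∑ i ∈ range (r + 1), ∑ j ∈ range (s + 1), (r.choose i * s.choose j) • g i j := by
  rw [Fintype.sum_equiv sumEquiv.toEquiv (fun S : Finset (Fin r ⊕ Fin s) =>
      g S.toLeft.card S.toRight.card) (fun x => g x.1.card x.2.card) fun S => rfl,
    Fintype.sum_prod_type]
  simp only [← powerset_univ]
  rw [sum_powerset_apply_card fun i => ∑ y ∈ powerset univ, g i (card y)]
  simp only [sum_powerset_apply_card, card_univ, Fintype.card_fin, smul_sum, mul_smul]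

open Classical in
/-- Removing a marked edge from a connected bipartite graph. -/
theorem Nbi_edge_removal (r s k : ℕ) :
    ∑ E ∈ connSet (univ : Finset (Fin r ⊕ Fin s)) k, E.card =
      ∑ E : Finset (Fin r × Fin s) with ConnOn univ E ∧ E.card + 2 = r + s + k, Eᶜ.card +
      ∑ i ∈ range (r + 1), ∑ j ∈ range (s + 1), r.choose i * s.choose j *
        (i * (s - j) * ∑ κ ∈ antidiagonal k, Nbi i j κ.1 * Nbi (r - i) (s - j) κ.2) := by
  classical
  rw [← card_sigma, ← card_filter_add_card_filter_not
    (fun x : Σ _ : Finset (Fin r × Fin s), Fin r × Fin s => ConnOn univ (x.1.erase x.2)),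
    card_nonbridge, card_bridge]
  congr 1
  · simp [card_sigma]
  · simp only [card_sigma, card_product, sum_const, smul_eq_mul, card_connSet]
    have := sum_sum_toLeft_toRight r s fun i j =>
      i * (s - j) * ∑ κ ∈ antidiagonal k, Nbi i j κ.1 * Nbi (r - i) (s - j) κ.2
    simp only [smul_eq_mul] at this
    rw [← this]
    refine sum_congr rfl fun S _ => ?_
    have hl : Sᶜ.toLeft = S.toLeftᶜ := by ext; simp
    have hr : Sᶜ.toRight = S.toRightᶜ := by ext; simp
    simp [hl, hr, card_compl]

theorem sum_card_connSet (r s k : ℕ) :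
    ∑ E ∈ connSet (univ : Finset (Fin r ⊕ Fin s)) k, (E.card : ℚ) =
      ((r : ℚ) + s + k - 1) * Nbi r s k := by
  rw [sum_congr rfl (g := fun _ => (r : ℚ) + s + k - 1), sum_const, card_connSet_fin,
    nsmul_eq_mul, mul_comm]
  intro E hE
  have h := (mem_connSet.1 hE).2
  rw [card_univ, Fintype.card_sum, Fintype.card_fin, Fintype.card_fin] at h
  have h' : (E.card : ℚ) + 1 = r + s + k := by exact_mod_cast h
  linarith

/-- Edge removal, as a recursion for trees. -/
theorem Nbi_recursion_zero (r s : ℕ) :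
    ((r : ℚ) + s - 1) * Nbi r s 0 =
      ∑ i ∈ range (r + 1), ∑ j ∈ range (s + 1), (r.choose i : ℚ) * s.choose j *
        (i * (s - j : ℕ) * ∑ κ ∈ antidiagonal 0, Nbi i j κ.1 * Nbi (r - i) (s - j) κ.2) := by
  classical
  have h := Nbi_edge_removal r s 0
  -- Trees have only bridges: a connected graph on r + s vertices cannot have r + s - 2 edges.
  rw [filter_false_of_mem, sum_empty, zero_add] at h
  · have h1 := sum_card_connSet r s 0
    rw [Nat.cast_zero, add_zero] at h1
    rw [← h1]
    exact_mod_cast h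
  · rintro E - ⟨h1, h2⟩
    have := h1.card_univ_le
    simp only [Fintype.card_sum, Fintype.card_fin] at this
    omega

/-- Edge removal, as a recursion for graphs of positive Betti number. -/
theorem Nbi_recursion_succ (r s k : ℕ) :
    ((r : ℚ) + s + k) * Nbi r s (k + 1) =
      (r * s - r - s - k + 1) * Nbi r s k +
      ∑ i ∈ range (r + 1), ∑ j ∈ range (s + 1), (r.choose i : ℚ) * s.choose j *
        (i * (s - j : ℕ) * ∑ κ ∈ antidiagonal (k + 1), Nbi i j κ.1 * Nbi (r - i) (s - j) κ.2) := by
  classical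
  have h := Nbi_edge_removal r s (k + 1)
  have h1 := sum_card_connSet r s (k + 1)
  -- The graphs left after deleting a non-bridge have Betti number `k`, hence r + s + k - 1 edges,
  -- and each has rs - (r + s + k - 1) non-edges.
  have h2 : ∑ E : Finset (Fin r × Fin s) with ConnOn univ E ∧ E.card + 2 = r + s + (k + 1),
      (Eᶜ.card : ℚ) = ((r : ℚ) * s - r - s - k + 1) * Nbi r s k := by
    have : (univ.filter fun E : Finset (Fin r × Fin s) =>
        ConnOn univ E ∧ E.card + 2 = r + s + (k + 1)) = connSet univ k := by
      ext E
      simp only [mem_filter, mem_univ, true_and, mem_connSet, card_univ, Fintype.card_sum,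
        Fintype.card_fin]
      exact and_congr_right fun _ => by omega
    rw [this, sum_congr rfl (g := fun _ => (r : ℚ) * s - r - s - k + 1), sum_const,
      card_connSet_fin, nsmul_eq_mul, mul_comm]
    intro E hE
    have h3 := (mem_connSet.1 hE).2
    have h4 := card_add_card_compl E
    rw [card_univ, Fintype.card_sum, Fintype.card_fin, Fintype.card_fin] at h3
    rw [Fintype.card_prod, Fintype.card_fin, Fintype.card_fin] at h4
    have h3' : (E.card : ℚ) + 1 = r + s + k := by exact_mod_cast h3
    have h4' : (E.card : ℚ) + Eᶜ.card = r * s := by exact_mod_cast h4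
    linarith
  rw [show (r : ℚ) + s + k = r + s + (k + 1 : ℕ) - 1 by push_cast; ring, ← h1, ← h2]
  exact_mod_cast h

end BipartiteEGF

/-! ### Differential equations for the generating functions -/

namespace BipartiteEGF

open Finset MvPowerSeries

theorem coeff_F (k : ℕ) (d : Fin 2 →₀ ℕ) :
    coeff d (F k) = (Nbi (d 0) (d 1) k : ℚ) / ((d 0).factorial * (d 1).factorial) := rfl

theorem coeff_euler (i : Fin 2) (f : MvPowerSeries (Fin 2) ℚ) (d : Fin 2 →₀ ℕ) :
    coeff d (euler i f) = d i * coeff d f := by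
  classical
  rw [euler, X_def, coeff_monomial_mul, one_mul]
  split_ifs with h
  · rw [coeff_pderiv, tsub_add_cancel_of_le h, mul_comm]
    have hi : 1 ≤ d i := by simpa using h i
    rw [Finsupp.tsub_apply, Finsupp.single_eq_same, Nat.cast_sub hi]
    simp
  · have hi : d i = 0 := by simpa [Finsupp.single_le_iff] using h
    simp [hi]

theorem euler_comm (i j : Fin 2) (f : MvPowerSeries (Fin 2) ℚ) :
    euler i (euler j f) = euler j (euler i f) := by
  ext d
  simp only [coeff_euler]
  ring

theorem sum_antidiagonal_fin_two {M : Type*} [AddCommMonoid M] (d : Fin 2 →₀ ℕ)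
    (g : ℕ → ℕ → ℕ → ℕ → M) :
    ∑ p ∈ antidiagonal d, g (p.1 0) (p.1 1) (p.2 0) (p.2 1) =
      ∑ i ∈ range (d 0 + 1), ∑ j ∈ range (d 1 + 1), g i j (d 0 - i) (d 1 - j) := by
  rw [← sum_product']
  refine sum_bij' (fun p _ => (p.1 0, p.1 1))
    (fun x _ => (Finsupp.equivFunOnFinite.symm ![x.1, x.2],
      Finsupp.equivFunOnFinite.symm ![d 0 - x.1, d 1 - x.2])) ?_ ?_ ?_ ?_ ?_
  · rintro ⟨p, q⟩ h
    rw [HasAntidiagonal.mem_antidiagonal] at h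
    subst h
    simp only [Finsupp.add_apply, mem_product, mem_range]
    omega
  · rintro ⟨i, j⟩ h
    simp only [mem_product, mem_range] at h
    rw [HasAntidiagonal.mem_antidiagonal]
    ext a
    fin_cases a <;> simp <;> omega
  · rintro ⟨p, q⟩ h
    rw [HasAntidiagonal.mem_antidiagonal] at h
    subst h
    ext a <;> fin_cases a <;> simp
  · rintro ⟨i, j⟩ _
    simp
  · rintro ⟨p, q⟩ h
    rw [HasAntidiagonal.mem_antidiagonal] at h
    subst h
    simp

/-- The Euler operators supply the choice of the two endpoints of the bridge, and the factorials
supply the binomials for distributing the labels. -/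
theorem coeff_euler_mul_euler (k l : ℕ) (d : Fin 2 →₀ ℕ) :
    coeff d (euler 0 (F k) * euler 1 (F l)) =
      (∑ i ∈ range (d 0 + 1), ∑ j ∈ range (d 1 + 1), ((d 0).choose i : ℚ) * (d 1).choose j *
        (i * (d 1 - j : ℕ) * (Nbi i j k * Nbi (d 0 - i) (d 1 - j) l))) /
      ((d 0).factorial * (d 1).factorial) := by
  classical
  rw [coeff_mul]
  simp only [coeff_euler, coeff_F]
  rw [sum_antidiagonal_fin_two d fun i j i' j' => (i : ℚ) * ((Nbi i j k : ℚ) /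
    (i.factorial * j.factorial)) * (j' * ((Nbi i' j' l : ℚ) / (i'.factorial * j'.factorial))),
    sum_div]
  refine sum_congr rfl fun i hi => ?_
  rw [sum_div]
  refine sum_congr rfl fun j hj => ?_
  rw [mem_range, Nat.lt_succ_iff] at hi hj
  rw [Nat.cast_choose ℚ hi, Nat.cast_choose ℚ hj]
  have := fun n : ℕ => (Nat.cast_ne_zero (R := ℚ)).2 n.factorial_ne_zero
  field_simp [this]

theorem coeff_sum_euler_mul_euler (k : ℕ) (d : Fin 2 →₀ ℕ) :
    coeff d (∑ κ ∈ antidiagonal k, euler 0 (F κ.1) * euler 1 (F κ.2)) =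
      (∑ i ∈ range (d 0 + 1), ∑ j ∈ range (d 1 + 1), ((d 0).choose i : ℚ) * (d 1).choose j *
        (i * (d 1 - j : ℕ) * ∑ κ ∈ antidiagonal k, Nbi i j κ.1 * Nbi (d 0 - i) (d 1 - j) κ.2)) /
      ((d 0).factorial * (d 1).factorial) := by
  rw [map_sum, sum_congr rfl fun κ _ => coeff_euler_mul_euler κ.1 κ.2 d, ← sum_div, sum_comm]
  congr 1
  refine sum_congr rfl fun i _ => ?_
  rw [sum_comm]
  refine sum_congr rfl fun j _ => ?_
  push_cast
  simp only [mul_sum]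

theorem F_zero_equation : euler 0 (F 0) + euler 1 (F 0) - F 0 = euler 0 (F 0) * euler 1 (F 0) := by
  have h : euler 0 (F 0) * euler 1 (F 0) =
      ∑ κ ∈ antidiagonal 0, euler 0 (F κ.1) * euler 1 (F κ.2) := by simp
  rw [h]
  ext d
  rw [coeff_sum_euler_mul_euler, ← Nbi_recursion_zero]
  simp only [map_add, map_sub, coeff_euler, coeff_F]
  ring

theorem F_succ_equation (k : ℕ) :
    euler 0 (F (k + 1)) + euler 1 (F (k + 1)) + k * F (k + 1) =
      euler 0 (euler 1 (F k)) - euler 0 (F k) - euler 1 (F k) - k * F k + F k +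
      ∑ κ ∈ antidiagonal (k + 1), euler 0 (F κ.1) * euler 1 (F κ.2) := by
  ext d
  have h := Nbi_recursion_succ (d 0) (d 1) k
  rw [map_add _ _ (∑ κ ∈ _, _), coeff_sum_euler_mul_euler, eq_sub_of_add_eq' h.symm]
  simp only [map_add, map_sub, coeff_euler, coeff_F, ← nsmul_eq_mul, map_nsmul]
  simp only [nsmul_eq_mul]
  ring

/-- The Euler operator as a derivation. -/
noncomputable def eulerDer (i : Fin 2) :
    Derivation ℚ (MvPowerSeries (Fin 2) ℚ) (MvPowerSeries (Fin 2) ℚ) :=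
  (X i : MvPowerSeries (Fin 2) ℚ) • pderiv ℚ i

/-! ### Uniqueness of solutions, degree by degree -/

theorem le_order_euler {f : MvPowerSeries (Fin 2) ℚ} {n : ℕ} (h : n ≤ f.order) (i : Fin 2) :
    n ≤ (euler i f).order := by
  refine nat_le_order fun d hd => ?_
  rw [coeff_euler, coeff_of_lt_order (lt_of_lt_of_le (by exact_mod_cast hd) h), mul_zero]

theorem le_order_mul_succ {f g : MvPowerSeries (Fin 2) ℚ} {n : ℕ} (hg : constantCoeff g = 0)
    (h : n ≤ f.order) : (n + 1 : ℕ) ≤ (g * f).order := by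
  refine le_trans ?_ (le_order_mul)
  have := one_le_order_iff_constCoeff_eq_zero.2 hg
  push_cast
  rw [add_comm]
  exact add_le_add this h

theorem le_order_add {f g : MvPowerSeries (Fin 2) ℚ} {n : ℕ} (hf : n ≤ f.order)
    (hg : n ≤ g.order) : n ≤ (f + g).order :=
  (le_min hf hg).trans min_order_le_add

/-- On the homogeneous part of degree `n` the operator acts as multiplication by n - c, which is
nonzero. -/
theorem le_order_succ_of_euler {u : MvPowerSeries (Fin 2) ℚ} {c : ℤ} {n : ℕ} (hn : c < n)
    (hu : n ≤ u.order) (h : (n + 1 : ℕ) ≤ (euler 0 u + euler 1 u - c * u).order) :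
    (n + 1 : ℕ) ≤ u.order := by
  refine nat_le_order fun d hd => ?_
  rcases Nat.lt_succ_iff_lt_or_eq.1 hd with hlt | heq
  · exact coeff_of_lt_order (lt_of_lt_of_le (by exact_mod_cast hlt) hu)
  · have h1 := coeff_of_lt_order (lt_of_lt_of_le (by exact_mod_cast hd) h)
    rw [← zsmul_eq_mul, map_sub, map_add, map_zsmul, coeff_euler, coeff_euler, zsmul_eq_mul] at h1
    have hd' : d 0 + d 1 = n := by rw [← heq, Finsupp.degree_eq_sum, Fin.sum_univ_two]
    have h2 : ((n : ℚ) - c) * coeff d u = 0 := by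
      rw [← hd', ← h1]
      push_cast
      ring
    refine (mul_eq_zero.1 h2).resolve_left (sub_ne_zero.2 ?_)
    exact_mod_cast hn.ne'

/-- Uniqueness for linear systems of two equations whose leading part is the total Euler operator
minus `c`. -/
theorem eq_zero_of_euler_system {u v : MvPowerSeries (Fin 2) ℚ} {c : ℤ} {m : ℕ} (hm : c < m)
    (hu : m ≤ u.order) (hv : m ≤ v.order)
    (hu' : ∀ n : ℕ, n ≤ u.order → n ≤ v.order →
      (n + 1 : ℕ) ≤ (euler 0 u + euler 1 u - c * u).order)
    (hv' : ∀ n : ℕ, n ≤ u.order → n ≤ v.order →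
      (n + 1 : ℕ) ≤ (euler 0 v + euler 1 v - c * v).order) : u = 0 ∧ v = 0 := by
  have key : ∀ n : ℕ, m ≤ n → n ≤ u.order ∧ n ≤ v.order := by
    intro n hn
    induction n, hn using Nat.le_induction with
    | base => exact ⟨hu, hv⟩
    | succ n hmn ih =>
      have hc : c < n := hm.trans_le (by exact_mod_cast hmn)
      exact ⟨le_order_succ_of_euler hc ih.1 (hu' n ih.1 ih.2),
        le_order_succ_of_euler hc ih.2 (hv' n ih.1 ih.2)⟩
  have key' : ∀ w : MvPowerSeries (Fin 2) ℚ, (∀ n : ℕ, m ≤ n → n ≤ w.order) → w = 0 := by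
    intro w hw
    ext d
    refine coeff_of_lt_order (lt_of_lt_of_le ?_ (hw (m + (d.degree + 1)) (by omega)))
    exact_mod_cast (by omega : d.degree < m + (d.degree + 1))
  exact ⟨key' u fun n hn => (key n hn).1, key' v fun n hn => (key n hn).2⟩

theorem eq_zero_of_euler_equation {u : MvPowerSeries (Fin 2) ℚ} {c : ℤ} {m : ℕ} (hm : c < m)
    (hu : m ≤ u.order)
    (hu' : ∀ n : ℕ, n ≤ u.order → (n + 1 : ℕ) ≤ (euler 0 u + euler 1 u - c * u).order) :
    u = 0 :=
  (eq_zero_of_euler_system hm hu hu (fun n h _ => hu' n h) fun n h _ => hu' n h).1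

/-! ### Second derivatives of the tree series -/

theorem euler_mul (i : Fin 2) (f g : MvPowerSeries (Fin 2) ℚ) :
    euler i (f * g) = f * euler i g + g * euler i f :=
  (eulerDer i).leibniz f g

theorem euler_add (i : Fin 2) (f g : MvPowerSeries (Fin 2) ℚ) :
    euler i (f + g) = euler i f + euler i g :=
  map_add (eulerDer i) f g

theorem euler_sub (i : Fin 2) (f g : MvPowerSeries (Fin 2) ℚ) :
    euler i (f - g) = euler i f - euler i g :=
  map_sub (eulerDer i) f g

theorem euler_one (i : Fin 2) : euler i 1 = 0 := (eulerDer i).map_one_eq_zero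

theorem constantCoeff_euler (i : Fin 2) (f : MvPowerSeries (Fin 2) ℚ) :
    constantCoeff (euler i f) = 0 := by
  simp [euler]

theorem euler_one_Tx : euler 1 Tx = euler 0 Ty := euler_comm 1 0 T

theorem constantCoeff_Tx : constantCoeff Tx = 0 := constantCoeff_euler 0 T

theorem constantCoeff_Ty : constantCoeff Ty = 0 := constantCoeff_euler 1 T

theorem constantCoeff_W : constantCoeff W = 0 := by
  rw [W, map_mul, constantCoeff_Tx, zero_mul]

theorem W_mul_inv : (1 - W) * (1 - W)⁻¹ = 1 :=
  MvPowerSeries.mul_inv_cancel _ (by simp [constantCoeff_W])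

theorem Tx_add_Ty_sub_T : Tx + Ty - T = Tx * Ty := F_zero_equation

theorem euler_zero_T_equation :
    euler 0 Tx + euler 0 Ty - Tx = euler 0 Tx * Ty + Tx * euler 0 Ty := by
  have h := congrArg (euler 0) Tx_add_Ty_sub_T
  rw [euler_sub, euler_add, euler_mul, show euler 0 T = Tx from rfl] at h
  rw [h]
  ring

theorem euler_one_T_equation :
    euler 0 Ty + euler 1 Ty - Ty = euler 0 Ty * Ty + Tx * euler 1 Ty := by
  have h := congrArg (euler 1) Tx_add_Ty_sub_T
  rw [euler_sub, euler_add, euler_mul, euler_one_Tx, show euler 1 T = Ty from rfl] at h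
  rw [h]
  ring

/-- Since the Euler operators commute, applying both to the tree equation leaves only first
derivatives of the mixed series `euler 0 Ty` among the third derivatives of `T`. -/
theorem euler_euler_T_equation :
    (1 - Ty) * euler 0 (euler 0 Ty) + (1 - Tx) * euler 1 (euler 0 Ty) =
      euler 0 Ty + euler 0 Tx * euler 1 Ty + euler 0 Ty ^ 2 := by
  have h := congrArg (euler 1) euler_zero_T_equation
  simp only [euler_sub, euler_add, euler_mul, euler_one_Tx] at h
  rw [euler_comm 1 0 Tx, euler_one_Tx] at h
  linear_combination h

/-- The coefficient at (r, s) carries the factor rs, which vanishes in degree below two. -/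
theorem two_le_order_euler_Ty : 2 ≤ (euler 0 Ty).order := by
  refine nat_le_order (n := 2) fun d hd => ?_
  rw [Ty, coeff_euler, coeff_euler]
  have h : d 0 + d 1 < 2 := by rwa [Finsupp.degree_eq_sum, Fin.sum_univ_two] at hd
  rcases (by omega : d 0 = 0 ∨ d 1 = 0) with h | h <;> simp [h]

theorem euler_Ty_mul : euler 0 Ty * (1 - W) = W := by
  rw [← sub_eq_zero]
  set M := euler 0 Ty with hM
  set A := euler 0 Tx with hA
  set B := euler 1 Ty with hB
  have h0 : A + M - Tx = A * Ty + Tx * M := euler_zero_T_equation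
  have h1 : M + B - Ty = M * Ty + Tx * B := euler_one_T_equation
  have hDM := euler_euler_T_equation
  rw [← hM, ← hA, ← hB] at hDM
  set U := M * (1 - W) - W with hU
  have hx := constantCoeff_Tx
  have hy := constantCoeff_Ty
  have hw := constantCoeff_W
  have eU : ∀ i, euler i U =
      euler i M * (1 - W) - (M + 1) * (Tx * euler i Ty + Ty * euler i Tx) := by
    intro i
    simp only [hU, W, euler_sub, euler_mul, euler_one]
    ring
  -- Each term on the right is `U` or a derivative of `U` times a factor without constant term, so
  -- it gains at least one degree.
  have key : euler 0 U + euler 1 U - (1 : ℤ) * U =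
      (Tx + Ty - W) * ((1 - Ty) * euler 0 U + (1 - Tx) * euler 1 U) +
      (Ty * euler 0 U + Tx * euler 1 U) +
      (2 * (1 - Tx) * (1 - Ty) * M - 2 * (Tx + Ty) + 3 * W) * U := by
    have hDU : (1 - Ty) * euler 0 U + (1 - Tx) * euler 1 U =
        (M + A * B + M ^ 2) * (1 - W) - (M + 1) * (2 * W) := by
      rw [eU, eU, euler_one_Tx, ← hM, ← hA, ← hB]
      have : W = Tx * Ty := rfl
      linear_combination (1 - W) * hDM - (M + 1) * (Ty * h0 + Tx * h1) + 2 * (M + 1) * this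
    -- The once differentiated equations express `A` and `B` through `M`; multiplying by (1 - T_x)(1
    -- - T_y) eliminates them without division.
    have hA' : (1 - Ty) * A = Tx - (1 - Tx) * M := by linear_combination h0
    have hB' : (1 - Tx) * B = Ty - (1 - Ty) * M := by linear_combination h1
    have hAB : (1 - Tx) * (1 - Ty) * (A * B) =
        (Tx - (1 - Tx) * M) * (Ty - (1 - Ty) * M) := by
      rw [← hA', ← hB']
      ring
    have hW : W = Tx * Ty := rfl
    have hK : (1 - Tx) * (1 - Ty) * ((1 - Ty) * euler 0 U + (1 - Tx) * euler 1 U) =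
        (2 * (1 - Tx) * (1 - Ty) * M + 2 * (1 - Tx) * (1 - Ty) - 1 + W) * U := by
      rw [hDU, hU]
      rw [hW] at *
      linear_combination (1 - Tx * Ty) * hAB
    rw [hW] at *
    push_cast
    linear_combination hK
  -- With c = 1 the parts of degree 0 and 1 must vanish beforehand; both `euler 0 Ty` and `W` start
  -- in degree two.
  refine eq_zero_of_euler_equation (c := 1) (m := 2) (by norm_num) ?_ ?_
  · have hWo : ((2 : ℕ) : ℕ∞) ≤ W.order := by
      have h1 : ((1 : ℕ) : ℕ∞) ≤ Ty.order := by
        exact_mod_cast one_le_order_iff_constCoeff_eq_zero.2 hy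
      exact le_order_mul_succ hx h1
    have : U = (euler 0 Ty) + ((-M - 1) * W) := by rw [hU]; ring
    rw [this]
    refine le_order_add two_le_order_euler_Ty (hWo.trans ?_)
    exact le_trans (le_add_of_nonneg_left zero_le) le_order_mul
  · intro n hn
    rw [key]
    have h0 := le_order_euler hn 0
    have h1 := le_order_euler hn 1
    have hmul : ∀ (g : MvPowerSeries (Fin 2) ℚ) {f : MvPowerSeries (Fin 2) ℚ},
        n ≤ f.order → n ≤ (g * f).order := fun g f h =>
      h.trans (le_trans (le_add_of_nonneg_left zero_le) le_order_mul)
    refine le_order_add (le_order_add (le_order_mul_succ ?_ (le_order_add (hmul _ h0) (hmul _ h1)))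
      (le_order_add (le_order_mul_succ hy h0) (le_order_mul_succ hx h1)))
      (le_order_mul_succ ?_ hn)
    · simp [hx, hy, hw]
    · simp [hx, hy, hw, hM, constantCoeff_euler]

theorem euler_zero_Ty : euler 0 Ty = W * (1 - W)⁻¹ := by
  linear_combination (1 - W)⁻¹ * euler_Ty_mul - euler 0 Ty * W_mul_inv

theorem one_sub_ne_zero {f : MvPowerSeries (Fin 2) ℚ} (hf : constantCoeff f = 0) : 1 - f ≠ 0 := by
  intro h
  have := congrArg constantCoeff h
  simp [hf] at this

/-- Once the mixed derivative is known, the differentiated tree equation is linear in `euler 0 Tx`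
with the cancellable coefficient 1 - T_y. -/
theorem euler_zero_Tx : euler 0 Tx = Tx * (1 - W)⁻¹ := by
  refine mul_left_cancel₀ (one_sub_ne_zero constantCoeff_Ty) ?_
  have h := euler_zero_T_equation
  rw [euler_zero_Ty] at h
  have hV := W_mul_inv
  have hW : W = Tx * Ty := rfl
  linear_combination h - Tx * hV - (1 - W)⁻¹ * hW

theorem euler_one_Ty : euler 1 Ty = Ty * (1 - W)⁻¹ := by
  refine mul_left_cancel₀ (one_sub_ne_zero constantCoeff_Tx) ?_
  have h := euler_one_T_equation
  rw [euler_zero_Ty] at h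
  have hV := W_mul_inv
  have hW : W = Tx * Ty := rfl
  linear_combination h - Ty * hV - (1 - W)⁻¹ * hW

theorem euler_W_inv (i : Fin 2) : euler i (1 - W)⁻¹ = (1 - W)⁻¹ ^ 2 * euler i W := by
  have h := congrArg (euler i) W_mul_inv
  rw [euler_mul, euler_sub, euler_one] at h
  linear_combination (1 - W)⁻¹ * h - euler i (1 - W)⁻¹ * W_mul_inv

theorem euler_zero_W : euler 0 W = W * (1 + Tx) * (1 - W)⁻¹ := by
  rw [W, euler_mul, euler_zero_Ty, euler_zero_Tx, ← W]
  rw [show W = Tx * Ty from rfl]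
  ring

theorem euler_one_W : euler 1 W = W * (1 + Ty) * (1 - W)⁻¹ := by
  rw [W, euler_mul, euler_one_Tx, euler_zero_Ty, euler_one_Ty, ← W]
  rw [show W = Tx * Ty from rfl]
  ring

/-! ### Betti numbers one and two -/

theorem F_one_equation :
    (1 - Ty) * euler 0 (F 1) + (1 - Tx) * euler 1 (F 1) = W * (1 - W)⁻¹ - W := by
  have h := F_succ_equation 0
  simp [Nat.antidiagonal_succ] at h
  have h0 : Tx + Ty - F 0 = Tx * Ty := Tx_add_Ty_sub_T
  have h1 : euler 0 (euler 1 (F 0)) = W * (1 - W)⁻¹ := euler_zero_Ty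
  have hx : euler 0 (F 0) = Tx := rfl
  have hy : euler 1 (F 0) = Ty := rfl
  rw [h1, hx, hy] at h
  rw [show W = Tx * Ty from rfl] at *
  linear_combination h - h0

theorem F_two_equation :
    (1 - Ty) * euler 0 (F 2) + (1 - Tx) * euler 1 (F 2) + F 2 =
      euler 0 (euler 1 (F 1)) - euler 0 (F 1) - euler 1 (F 1) + euler 0 (F 1) * euler 1 (F 1) := by
  have h := F_succ_equation 1
  simp [Nat.antidiagonal_succ] at h
  have hx : euler 0 (F 0) = Tx := rfl
  have hy : euler 1 (F 0) = Ty := rfl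
  rw [hx, hy] at h
  linear_combination h

theorem half_add_half : (C (1 / 2 : ℚ) + C (1 / 2 : ℚ) : MvPowerSeries (Fin 2) ℚ) = 1 := by
  rw [← map_add, ← map_one C]
  norm_num

theorem euler_C_mul (i : Fin 2) (r : ℚ) (f : MvPowerSeries (Fin 2) ℚ) :
    euler i (C r * f) = C r * euler i f := by
  rw [← smul_eq_C_mul, ← smul_eq_C_mul]
  exact (eulerDer i).map_smul r f

/-- The claimed gradient of F_1 satisfies the differentiated equation. Here P, Q, V, c stand for
T_x, T_y, 1/(1 - W), 1/2, of which only the ring relations matter; exchanging P and Q gives the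
other component. -/
theorem betti_one_identity {R : Type*} [CommRing R] {P Q V c W : R} (hW : W = P * Q)
    (hV : (1 - W) * V = 1) (hc : c + c = 1) :
    (1 - Q) * (c * (2 * W * (W * (1 + P) * V) * (1 + P) * V ^ 2 + W ^ 2 * (P * V) * V ^ 2 +
        W ^ 2 * (1 + P) * (2 * V * (V ^ 2 * (W * (1 + P) * V))))) +
      (1 - P) * (c * (2 * W * (W * (1 + Q) * V) * (1 + P) * V ^ 2 + W ^ 2 * (W * V) * V ^ 2 +
        W ^ 2 * (1 + P) * (2 * V * (V ^ 2 * (W * (1 + Q) * V))))) =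
      W * V * (c * (W ^ 2 * (1 + P) * V ^ 2)) + P * V * (c * (W ^ 2 * (1 + Q) * V ^ 2)) +
        (V ^ 2 - 1) * (W * (1 + P) * V) := by
  subst hW
  grind

/-- The equation for F_2 holds for the claimed closed form, multiplied by 24 to clear the
denominator; the letters are as in `betti_one_identity`. -/
theorem betti_two_identity {R : Type*} [CommRing R] {P Q V c W : R} (hW : W = P * Q)
    (hV : (1 - W) * V = 1) (hc : c + c = 1) :
    (1 - Q) * (2 * W * (W * (1 + P) * V) * (V ^ 3 * ((2 + 3 * W) * (P + Q) + 2 * W * (6 - W))) +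
        W ^ 2 * (3 * V ^ 2 * (V ^ 2 * (W * (1 + P) * V)) *
          ((2 + 3 * W) * (P + Q) + 2 * W * (6 - W)) +
        V ^ 3 * (3 * (W * (1 + P) * V) * (P + Q) + (2 + 3 * W) * (P * V + W * V) +
          (12 - 4 * W) * (W * (1 + P) * V)))) +
      (1 - P) * (2 * W * (W * (1 + Q) * V) * (V ^ 3 * ((2 + 3 * W) * (P + Q) + 2 * W * (6 - W))) +
        W ^ 2 * (3 * V ^ 2 * (V ^ 2 * (W * (1 + Q) * V)) *
          ((2 + 3 * W) * (P + Q) + 2 * W * (6 - W)) +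
        V ^ 3 * (3 * (W * (1 + Q) * V) * (P + Q) + (2 + 3 * W) * (W * V + Q * V) +
          (12 - 4 * W) * (W * (1 + Q) * V)))) +
      W ^ 2 * (V ^ 3 * ((2 + 3 * W) * (P + Q) + 2 * W * (6 - W))) =
      24 * (c * (2 * W * (W * (1 + P) * V) * (1 + Q) * V ^ 2 + W ^ 2 * (W * V) * V ^ 2 +
        W ^ 2 * (1 + Q) * (2 * V * (V ^ 2 * (W * (1 + P) * V)))) -
      c * (W ^ 2 * (1 + P) * V ^ 2) - c * (W ^ 2 * (1 + Q) * V ^ 2) +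
      c * (W ^ 2 * (1 + P) * V ^ 2) * (c * (W ^ 2 * (1 + Q) * V ^ 2))) := by
  subst hW
  grind

theorem euler_betti_one (i : Fin 2) (f : MvPowerSeries (Fin 2) ℚ) :
    euler i (C (1 / 2) * (W ^ 2 * (1 + f) * (1 - W)⁻¹ ^ 2)) =
      C (1 / 2) * (2 * W * euler i W * (1 + f) * (1 - W)⁻¹ ^ 2 +
        W ^ 2 * euler i f * (1 - W)⁻¹ ^ 2 +
        W ^ 2 * (1 + f) * (2 * (1 - W)⁻¹ * ((1 - W)⁻¹ ^ 2 * euler i W))) := by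
  rw [euler_C_mul]
  simp only [pow_two, euler_add, euler_mul, euler_one, euler_W_inv]
  ring

theorem le_order_of_constantCoeff {f : MvPowerSeries (Fin 2) ℚ} (h : constantCoeff f = 0) :
    ((1 : ℕ) : ℕ∞) ≤ f.order := by
  exact_mod_cast one_le_order_iff_constCoeff_eq_zero.2 h

theorem euler_F_one :
    euler 0 (F 1) = C (1 / 2) * (W ^ 2 * (1 + Tx) * (1 - W)⁻¹ ^ 2) ∧
      euler 1 (F 1) = C (1 / 2) * (W ^ 2 * (1 + Ty) * (1 - W)⁻¹ ^ 2) := by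
  have hV := W_mul_inv
  have hW : W = Tx * Ty := rfl
  -- Differentiating the single equation for F_1 and commuting mixed derivatives gives a coupled
  -- first-order system for the two components of the gradient.
  have hD : ∀ i, (1 - Ty) * euler i (euler 0 (F 1)) + (1 - Tx) * euler i (euler 1 (F 1)) =
      euler i Ty * euler 0 (F 1) + euler i Tx * euler 1 (F 1) +
        ((1 - W)⁻¹ ^ 2 - 1) * euler i W := by
    intro i
    have h := congrArg (euler i) F_one_equation
    simp only [euler_add, euler_sub, euler_mul, euler_one, euler_W_inv] at h
    linear_combination h - (1 - W)⁻¹ * euler i W * hV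
  have hD0 := hD 0
  have hD1 := hD 1
  rw [euler_comm 0 1, euler_zero_Tx, euler_zero_Ty, euler_zero_W] at hD0
  rw [euler_comm 1 0, euler_one_Tx, euler_zero_Ty, euler_one_Ty, euler_one_W] at hD1
  have e0 := fun f => euler_betti_one 0 f
  have e1 := fun f => euler_betti_one 1 f
  have i0 := betti_one_identity hW hV half_add_half
  have i1 := betti_one_identity (hW.trans (mul_comm _ _)) hV half_add_half
  set V := (1 - W)⁻¹
  rw [← sub_eq_zero, ← sub_eq_zero (a := euler 1 (F 1))]
  set u := euler 0 (F 1) - C (1 / 2 : ℚ) * (W ^ 2 * (1 + Tx) * V ^ 2) with hu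
  set v := euler 1 (F 1) - C (1 / 2 : ℚ) * (W ^ 2 * (1 + Ty) * V ^ 2) with hv
  have eu : euler 0 u + euler 1 u - (0 : ℤ) * u =
      Ty * euler 0 u + Tx * euler 1 u + (W * V * u + Tx * V * v) := by
    rw [hu, hv, euler_sub, euler_sub, e0, e1, euler_zero_W, euler_one_W, euler_one_Tx,
      euler_zero_Ty, euler_zero_Tx]
    push_cast
    linear_combination hD0 - i0
  have ev : euler 0 v + euler 1 v - (0 : ℤ) * v =
      Ty * euler 0 v + Tx * euler 1 v + (Ty * V * u + W * V * v) := by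
    rw [hu, hv, euler_sub, euler_sub, e0, e1, euler_zero_W, euler_one_W, euler_one_Ty,
      euler_zero_Ty]
    push_cast
    linear_combination hD1 - i1
  have hx := constantCoeff_Tx
  have hy := constantCoeff_Ty
  have hw := constantCoeff_W
  -- With c = 0 only the constant terms have to vanish beforehand, and Euler derivatives have none.
  refine eq_zero_of_euler_system (c := 0) (m := 1) (by norm_num)
    (le_order_of_constantCoeff ?_) (le_order_of_constantCoeff ?_) ?_ ?_
  · simp [hu, constantCoeff_euler, hw]
  · simp [hv, constantCoeff_euler, hw]
  · intro n h1 h2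
    rw [eu]
    refine le_order_add (le_order_add (le_order_mul_succ hy (le_order_euler h1 0))
      (le_order_mul_succ hx (le_order_euler h1 1)))
      (le_order_add (le_order_mul_succ ?_ h1) (le_order_mul_succ ?_ h2)) <;> simp [hx, hw]
  · intro n h1 h2
    rw [ev]
    refine le_order_add (le_order_add (le_order_mul_succ hy (le_order_euler h2 0))
      (le_order_mul_succ hx (le_order_euler h2 1)))
      (le_order_add (le_order_mul_succ ?_ h1) (le_order_mul_succ ?_ h2)) <;> simp [hy, hw]

/-- The denominator is cleared before substituting, since substitution is a ring homomorphism;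
dividing by (1 - W)³ afterwards gives the closed form. -/
theorem subst_f₂ : 24 * subst ![Z, W] f₂ =
    W ^ 2 * ((1 - W)⁻¹ ^ 3 * ((2 + 3 * W) * Z + 2 * W * (6 - W))) := by
  have h : 24 * (1 - X 1) ^ 3 * f₂ =
      X 1 ^ 2 * ((2 + 3 * X 1) * X 0 + 2 * X 1 * (6 - X 1)) := by
    rw [f₂]
    linear_combination (X 1 ^ 2 * ((2 + 3 * X 1) * X 0 + 2 * X 1 * (6 - X 1))) *
      f₂_denominator_mul_inv
  have hs := congrArg (substAlgHom (R := ℚ) hasSubst_Z_W) h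
  simp only [map_mul, map_pow, map_sub, map_add, map_one, map_ofNat,
    substAlgHom_apply, subst_X hasSubst_Z_W, Matrix.cons_val_zero, Matrix.cons_val_one] at hs
  have hV : (1 - W) ^ 3 * (1 - W)⁻¹ ^ 3 = 1 := by rw [← mul_pow, W_mul_inv, one_pow]
  linear_combination (1 - W)⁻¹ ^ 3 * hs - 24 * subst ![Z, W] f₂ * hV

theorem euler_natCast_mul (i : Fin 2) (n : ℕ) (f : MvPowerSeries (Fin 2) ℚ) :
    euler i (n * f) = n * euler i f := by
  rw [← nsmul_eq_mul, ← nsmul_eq_mul]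
  exact map_nsmul (eulerDer i) n f

theorem euler_betti_two (i : Fin 2) :
    24 * euler i (subst ![Z, W] f₂) =
      2 * W * euler i W * ((1 - W)⁻¹ ^ 3 * ((2 + 3 * W) * Z + 2 * W * (6 - W))) +
        W ^ 2 * (3 * (1 - W)⁻¹ ^ 2 * ((1 - W)⁻¹ ^ 2 * euler i W) *
          ((2 + 3 * W) * Z + 2 * W * (6 - W)) +
        (1 - W)⁻¹ ^ 3 * (3 * euler i W * Z + (2 + 3 * W) * (euler i Tx + euler i Ty) +
          (12 - 4 * W) * euler i W)) := by
  have h := euler_natCast_mul i 24 (subst ![Z, W] f₂)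
  have hZ : euler i Z = euler i Tx + euler i Ty := euler_add i Tx Ty
  have hn : ∀ n : ℕ, euler i (n : MvPowerSeries (Fin 2) ℚ) = 0 := (eulerDer i).map_natCast
  have h2 : euler i (2 : MvPowerSeries (Fin 2) ℚ) = 0 := hn 2
  have h3 : euler i (3 : MvPowerSeries (Fin 2) ℚ) = 0 := hn 3
  have h6 : euler i (6 : MvPowerSeries (Fin 2) ℚ) = 0 := hn 6
  push_cast at h
  rw [← h, subst_f₂]
  simp only [pow_succ, pow_zero, one_mul, euler_add, euler_sub, euler_mul, euler_W_inv, hZ, h2, h3,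
    h6]
  ring

theorem F_two_eq : F 2 = subst ![Z, W] f₂ := by
  have hW : W = Tx * Ty := rfl
  have hZ : Z = Tx + Ty := rfl
  have hF := F_two_equation
  rw [euler_F_one.1, euler_F_one.2, euler_betti_one, euler_zero_W, euler_zero_Ty] at hF
  have e0 := euler_betti_two 0
  have e1 := euler_betti_two 1
  have hs := subst_f₂
  rw [euler_zero_W, euler_zero_Tx, euler_zero_Ty, hZ] at e0
  rw [euler_one_W, euler_one_Tx, euler_zero_Ty, euler_one_Ty, hZ] at e1
  rw [hZ] at hs
  have key := betti_two_identity hW W_mul_inv half_add_half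
  rw [← e0, ← e1, ← hs, ← hF] at key
  rw [← hZ] at *
  set Φ := subst ![Z, W] f₂
  rw [← sub_eq_zero]
  set u := F 2 - Φ with hu
  have h24 : (24 : MvPowerSeries (Fin 2) ℚ) ≠ 0 := by
    intro h
    have h' := congrArg constantCoeff h
    rw [map_ofNat, map_zero] at h'
    norm_num at h'
  -- The zeroth-order term of the F_2 equation makes c = -1: the operator acts as n + 1 in degree n,
  -- never zero, so no initial condition is needed.
  have eu : euler 0 u + euler 1 u - (-1 : ℤ) * u = Ty * euler 0 u + Tx * euler 1 u := by
    refine mul_left_cancel₀ h24 ?_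
    rw [hu, euler_sub, euler_sub]
    push_cast
    linear_combination -key
  refine eq_zero_of_euler_equation (c := -1) (m := 0) (by norm_num) (by simp) fun n hn => ?_
  rw [eu]
  exact le_order_add (le_order_mul_succ constantCoeff_Ty (le_order_euler hn 0))
    (le_order_mul_succ constantCoeff_Tx (le_order_euler hn 1))

end BipartiteEGF

theorem theorem1p2 :
    BipartiteEGF.F 2 =
      MvPowerSeries.subst ![BipartiteEGF.Z, BipartiteEGF.W] BipartiteEGF.f₂ :=
  BipartiteEGF.F_two_eq
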